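/- Let $d\ge 3$ be an integer and $c>0$. For $f\colon[0,\infty)\to\mathbb R$ let $$\mathcal S_d[f](s)=\int_0^1 f(ts)\,\varrho_d(t)\,dt\quad(s\ge 0),\qquad \varrho_d(t)=\frac{2\Gamma(d/2)}{\sqrt{\pi}\,\Gamma((d-1)/2)}(1-t^2)^{\frac{d-3}{2}},$$ and let $\omega_{d-1}=2\pi^{d/2}/\Gamma(d/2)$. Put $F(s)=(c^2+s^2)^{-1/2}$ and $f(t)=c^{d-1}(c^2+t^2)^{-d/2}$, where the latter formula defines $f$ on all of $\mathbb R$. Then: 1. $F=\mathcal S_d[f]$ on $[0,\infty)$, where the defining integral converges absolutely for every $s\ge 0$. 2. $f\in L^1(\mathbb R)$, and its Fourier transform $\mathcal F_1[f](r)=\int_{\mathbb R} f(x)e^{-2\pi i x r}\,dx$ satisfies, for every $r\in\mathbb R$, $$\mathcal F_1[f](r)=\omega_{d-1}\,(c|r|)^{\frac{d-1}{2}}\,K_{\frac{d-1}{2}}(2\pi c|r|),$$ where $K_\nu(x)=\int_0^\infty e^{-x\cosh t}\cosh(\nu t)\,dt$ ($x>0$) is the modified Bessel function of the second kind, and for $r=0$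 the right-hand side is read as its limit as $r\to 0$. -/

import Mathlib

open Set Filter Topology MeasureTheory
open scoped FourierTransform

noncomputable section

/-- The density `ϱ_d(t) = c_d (1 - t²)^((d-3)/2)` on `(0,1)`, where
`c_d = 2 Γ(d/2) / (√π Γ((d-1)/2))`. -/
def slicingDensity (d : ℕ) (t : ℝ) : ℝ :=
  2 * Real.Gamma ((d : ℝ) / 2) / (Real.sqrt Real.pi * Real.Gamma (((d : ℝ) - 1) / 2)) *
    (1 - t ^ 2) ^ (((d : ℝ) - 3) / 2)

/-- The slicing operator `S_d[f](s) = ∫₀¹ f(ts) ϱ_d(t) dt`. -/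
def slicing (d : ℕ) (f : ℝ → ℝ) (s : ℝ) : ℝ :=
  ∫ t in (0 : ℝ)..1, f (t * s) * slicingDensity d t

/-- The surface measure `ω_{d-1} = 2 π^(d/2) / Γ(d/2)` of the unit sphere in `ℝ^d`. -/
def sphereArea (d : ℕ) : ℝ :=
  2 * Real.pi ^ ((d : ℝ) / 2) / Real.Gamma ((d : ℝ) / 2)

/-- The modified Bessel function of the second kind, of real order `ν` and argument `x > 0`:
`K_ν(x) = ∫₀^∞ exp(-x cosh t) cosh(ν t) dt` (the integral converges for every `x > 0`). -/
def besselK (ν x : ℝ) : ℝ :=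
  ∫ t in Ioi (0 : ℝ), Real.exp (-x * Real.cosh t) * Real.cosh (ν * t)

/-- The basis function `F(s) = (c² + s²)^(-1/2)` of the inverse multiquadric kernel. -/
def imqBasis (c s : ℝ) : ℝ :=
  (c ^ 2 + s ^ 2) ^ (-(1 / 2) : ℝ)

/-- The function `f(t) = c^(d-1) (c² + t²)^(-d/2)`. -/
def imqSlice (d : ℕ) (c t : ℝ) : ℝ :=
  c ^ ((d : ℝ) - 1) * (c ^ 2 + t ^ 2) ^ (-((d : ℝ) / 2))

/-- The function `ω_{d-1} (c|r|)^((d-1)/2) K_{(d-1)/2}(2πc|r|)`, meant for `r ≠ 0`. -/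
def imqSliceFourier (d : ℕ) (c r : ℝ) : ℝ :=
  sphereArea d * (c * |r|) ^ (((d : ℝ) - 1) / 2) *
    besselK (((d : ℝ) - 1) / 2) (2 * Real.pi * c * |r|)

end

/-! The slicing identity is a change of variables: `v = t √(c² + s²) / √(c² + t² s²)` maps `[0,1]`
increasingly onto itself and pulls the probability density `ϱ_d` back to `√(c² + s²) f(ts) ϱ_d(t)`.
Total mass one then gives `F(s)` (`slicing_imqSlice`). For the Fourier transform, a Gamma integral
writes `f` as a mixture of Gaussians. By Fubini each Gaussian is transformed separately, and the
remaining integral over the mixing parameter `u` is a Bessel integral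
(`integral_rpow_mul_exp_neg_add_inv`). The value at `r = 0` comes from continuity of the Fourier
transform of an integrable function. -/

theorem integral_rpow_mul_one_sub_rpow {α β : ℝ} (hα : 0 < α) (hβ : 0 < β) :
    ∫ x in (0 : ℝ)..1, x ^ (α - 1) * (1 - x) ^ (β - 1) = ProbabilityTheory.beta α β := by
  have h : Complex.betaIntegral α β =
      ((∫ x in (0 : ℝ)..1, x ^ (α - 1) * (1 - x) ^ (β - 1) : ℝ) : ℂ) := by
    rw [Complex.betaIntegral, ← intervalIntegral.integral_ofReal]
    refine intervalIntegral.integral_congr fun x hx => ?_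
    rw [uIcc_of_le zero_le_one] at hx
    push_cast [Complex.ofReal_cpow hx.1, Complex.ofReal_cpow (sub_nonneg.2 hx.2)]
    rfl
  rw [ProbabilityTheory.beta_eq_betaIntegralReal α β hα hβ, h, Complex.ofReal_re]

theorem integral_one_sub_sq_rpow {a : ℝ} (ha : -1 < a) :
    ∫ t in (0 : ℝ)..1, (1 - t ^ 2) ^ a =
      √Real.pi * Real.Gamma (a + 1) / (2 * Real.Gamma (a + 3 / 2)) := by
  have h := intervalIntegral.integral_comp_mul_deriv_of_deriv_nonneg (a := 0) (b := 1)
    (f := fun t : ℝ => t ^ 2) (f' := fun t => 2 * t)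
    (g := fun x : ℝ => x ^ ((1 / 2 : ℝ) - 1) * (1 - x) ^ (a + 1 - 1)) (by fun_prop)
    (fun x _ => by simpa using hasDerivAt_pow 2 x)
    (fun x hx => by
      rw [min_eq_left zero_le_one] at hx
      linarith [hx.1])
  -- The point `t = 0` is excluded: there the left side is `0` and the right side is `2`.
  have h2 : ∀ t ∈ Ioc (0 : ℝ) 1,
      ((fun x : ℝ => x ^ ((1 / 2 : ℝ) - 1) * (1 - x) ^ (a + 1 - 1)) ∘ fun t : ℝ => t ^ 2) t *
        (2 * t) = 2 * (1 - t ^ 2) ^ a := by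
    intro t ht
    have : (t ^ 2) ^ ((1 / 2 : ℝ) - 1) = t⁻¹ := by
      rw [← Real.rpow_natCast, ← Real.rpow_mul ht.1.le, ← Real.rpow_neg_one]
      norm_num
    have ht0 := ht.1.ne'
    simp only [Function.comp, this, add_sub_cancel_right]
    field_simp
  rw [intervalIntegral.integral_congr_ae (g := fun t : ℝ => 2 * (1 - t ^ 2) ^ a)
    (ae_of_all _ fun t ht => h2 t (by rwa [uIoc_of_le zero_le_one] at ht)),
    intervalIntegral.integral_const_mul] at h
  norm_num only at h
  have h3 := integral_rpow_mul_one_sub_rpow (α := 1 / 2) (β := a + 1) (by norm_num) (by linarith)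
  norm_num only at h3
  rw [h3, ProbabilityTheory.beta, Real.Gamma_one_half_eq] at h
  rw [show a + 3 / 2 = 1 / 2 + (a + 1) by ring, mul_comm (2 : ℝ), ← div_div, ← h]
  ring

theorem integral_slicingDensity {d : ℕ} (hd : 3 ≤ d) :
    ∫ t in (0 : ℝ)..1, slicingDensity d t = 1 := by
  have hd' : (3 : ℝ) ≤ d := by exact_mod_cast hd
  simp only [slicingDensity]
  rw [intervalIntegral.integral_const_mul, integral_one_sub_sq_rpow (by linarith),
    show ((d : ℝ) - 3) / 2 + 1 = (d - 1) / 2 by ring,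
    show ((d : ℝ) - 3) / 2 + 3 / 2 = d / 2 by ring]
  have := Real.Gamma_pos_of_pos (show 0 < (d : ℝ) / 2 by linarith)
  have := Real.Gamma_pos_of_pos (show 0 < ((d : ℝ) - 1) / 2 by linarith)
  have := Real.sqrt_pos.2 Real.pi_pos
  field_simp

theorem continuous_slicingDensity {d : ℕ} (hd : 3 ≤ d) : Continuous (slicingDensity d) := by
  have hd' : (3 : ℝ) ≤ d := by exact_mod_cast hd
  exact continuous_const.mul
    (Continuous.rpow_const (by fun_prop) fun _ => Or.inr (by linarith))

theorem continuous_imqSlice (d : ℕ) {c : ℝ} (hc : 0 < c) : Continuous (imqSlice d c) :=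
  continuous_const.mul
    (Continuous.rpow_const (by fun_prop) fun t => Or.inl (by positivity))

/-- Substituting `v = t √(c² + s²) / √(c² + t² s²)` turns the density at `v` into the sliced
integrand at `t`. -/
theorem slicing_imqSlice {d : ℕ} (hd : 3 ≤ d) {c : ℝ} (hc : 0 < c) (s : ℝ) :
    slicing d (imqSlice d c) s = imqBasis c s := by
  have hD : 0 < √(c ^ 2 + s ^ 2) := Real.sqrt_pos.2 (by positivity)
  have hq : ∀ t : ℝ, 0 < c ^ 2 + (t * s) ^ 2 := fun t => by positivity
  have hder : ∀ t : ℝ, HasDerivAt (fun t : ℝ => t * √(c ^ 2 + s ^ 2) / √(c ^ 2 + (t * s) ^ 2))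
      (√(c ^ 2 + s ^ 2) * c ^ 2 / (c ^ 2 + (t * s) ^ 2) ^ (3 / 2 : ℝ)) t := by
    intro t
    have hs := Real.sqrt_pos.2 (hq t)
    have h1 : HasDerivAt (fun t : ℝ => c ^ 2 + (t * s) ^ 2) (2 * (t * s) * s) t := by
      simpa using (((hasDerivAt_id t).mul_const s).pow 2).const_add (c ^ 2)
    have h2 := ((hasDerivAt_id t).mul_const √(c ^ 2 + s ^ 2)).div (h1.sqrt (hq t).ne') hs.ne'
    refine h2.congr_deriv ?_
    have h3 : (c ^ 2 + (t * s) ^ 2) ^ (3 / 2 : ℝ) = √(c ^ 2 + (t * s) ^ 2) ^ 3 := by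
      rw [Real.sqrt_eq_rpow, ← Real.rpow_natCast (_ ^ (1 / 2 : ℝ)), ← Real.rpow_mul (hq t).le]
      norm_num
    have h4 := Real.sq_sqrt (hq t).le
    rw [h3]
    generalize √(c ^ 2 + (t * s) ^ 2) = q at hs h4 ⊢
    simp only [id]
    field_simp
    rw [h4]
    ring
  have h := intervalIntegral.integral_comp_mul_deriv_of_deriv_nonneg (a := 0) (b := 1)
    (g := slicingDensity d) (fun t _ => (hder t).continuousAt.continuousWithinAt)
    (fun t _ => hder t) (fun t _ => by have := hq t; positivity)
  rw [one_mul, one_mul, zero_mul, zero_div, div_self hD.ne', integral_slicingDensity hd] at h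
  have key : ∀ t ∈ uIcc (0 : ℝ) 1, imqSlice d c (t * s) * slicingDensity d t =
      (√(c ^ 2 + s ^ 2))⁻¹ *
        ((slicingDensity d ∘ fun t : ℝ => t * √(c ^ 2 + s ^ 2) / √(c ^ 2 + (t * s) ^ 2)) t *
          (√(c ^ 2 + s ^ 2) * c ^ 2 / (c ^ 2 + (t * s) ^ 2) ^ (3 / 2 : ℝ))) := by
    intro t ht
    rw [uIcc_of_le zero_le_one] at ht
    have ht2 : 0 ≤ 1 - t ^ 2 := by nlinarith [ht.1, ht.2]
    have h1 : 1 - (t * √(c ^ 2 + s ^ 2) / √(c ^ 2 + (t * s) ^ 2)) ^ 2 =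
        c ^ 2 * (1 - t ^ 2) / (c ^ 2 + (t * s) ^ 2) := by
      have := hq t
      rw [div_pow, mul_pow, Real.sq_sqrt (hq t).le, Real.sq_sqrt (by positivity)]
      field_simp
      ring
    -- The density at `v` supplies `c^(d-3)` and `dv/dt` supplies `c²`, which is the normalisation
    -- of `f`.
    have h2 : (c ^ 2) ^ (((d : ℝ) - 3) / 2) * c ^ 2 = c ^ ((d : ℝ) - 1) := by
      rw [← Real.rpow_natCast c 2, ← Real.rpow_mul hc.le, ← Real.rpow_add hc]
      congr 1
      push_cast
      ring
    have h3 : (c ^ 2 + (t * s) ^ 2) ^ (-((d : ℝ) / 2)) =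
        ((c ^ 2 + (t * s) ^ 2) ^ (((d : ℝ) - 3) / 2))⁻¹ *
          ((c ^ 2 + (t * s) ^ 2) ^ (3 / 2 : ℝ))⁻¹ := by
      rw [← mul_inv, ← Real.rpow_add (hq t), ← Real.rpow_neg (hq t).le]
      congr 1
      ring
    simp only [Function.comp, slicingDensity, imqSlice]
    rw [h1, Real.div_rpow (by positivity) (hq t).le, Real.mul_rpow (by positivity) ht2, h3, ← h2]
    field_simp
  rw [slicing, intervalIntegral.integral_congr key, intervalIntegral.integral_const_mul, h,
    mul_one, imqBasis, Real.rpow_neg (by positivity), Real.sqrt_eq_rpow]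

theorem integrable_imqSlice {d : ℕ} (hd : 2 ≤ d) {c : ℝ} (hc : 0 < c) :
    Integrable (imqSlice d c) := by
  have h := (integrable_rpow_neg_one_add_norm_sq (E := ℝ) (μ := volume) (r := d)
    (by rw [Module.finrank_self]; exact_mod_cast hd)).comp_div hc.ne'
  refine (h.const_mul c⁻¹).congr (ae_of_all _ fun t => ?_)
  have h1 : c ^ 2 + t ^ 2 = c ^ 2 * (1 + ‖t / c‖ ^ 2) := by
    rw [Real.norm_eq_abs, sq_abs]
    field_simp
  have h2 : c ^ ((d : ℝ) - 1) * (c ^ 2) ^ (-((d : ℝ) / 2)) = c⁻¹ := by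
    rw [← Real.rpow_natCast c 2, ← Real.rpow_mul hc.le, ← Real.rpow_add hc, ← Real.rpow_neg_one]
    congr 1
    push_cast
    ring
  simp only [imqSlice]
  rw [h1, Real.mul_rpow (by positivity) (by positivity), ← mul_assoc, h2, neg_div]

theorem integral_eq_integral_Ioi_add_comp_neg {f : ℝ → ℝ} (hf : Integrable f) :
    ∫ x, f x = ∫ x in Ioi (0 : ℝ), (f x + f (-x)) := by
  rw [integral_add hf.integrableOn hf.comp_neg.integrableOn, integral_comp_neg_Ioi, neg_zero,
    add_comm, intervalIntegral.integral_Iic_add_Ioi hf.integrableOn hf.integrableOn]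

theorem integrableOn_rpow_mul_exp_neg_mul_Ioi {a r : ℝ} (ha : 0 < a) (hr : 0 < r) :
    IntegrableOn (fun u : ℝ => u ^ (a - 1) * Real.exp (-(r * u))) (Ioi 0) := by
  have := integrableOn_rpow_mul_exp_neg_mul_rpow (p := 1) (s := a - 1) (b := r)
    (by linarith) one_pos hr
  simpa using this

/-- The substitution `u = (B/A) e^w` balances the two terms: `A² u + B²/u = 2AB cosh w`. Folding `w`
with `-w` then turns `e^(νw)` into `2 cosh(νw)`. -/
theorem integral_rpow_mul_exp_neg_add_inv {ν A B : ℝ} (hν : 0 < ν) (hA : 0 < A) (hB : 0 < B) :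
    ∫ u in Ioi (0 : ℝ), u ^ (ν - 1) * Real.exp (-(A ^ 2 * u + B ^ 2 / u)) =
      2 * (B / A) ^ ν * besselK ν (2 * A * B) := by
  have hBA : 0 < B / A := div_pos hB hA
  set g : ℝ → ℝ := fun u => u ^ (ν - 1) * Real.exp (-(A ^ 2 * u + B ^ 2 / u)) with hg
  -- Dropping `B²/u` leaves a Gamma integrand as majorant. Integrability is what permits the folding
  -- at `w = 0`.
  have hgint : IntegrableOn g (Ioi 0) := by
    refine Integrable.mono' (integrableOn_rpow_mul_exp_neg_mul_Ioi hν (pow_pos hA 2))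
      (by fun_prop) ?_
    filter_upwards [ae_restrict_mem measurableSet_Ioi] with u (hu : 0 < u)
    have : 0 ≤ B ^ 2 / u := by positivity
    rw [hg, Real.norm_of_nonneg (by positivity)]
    exact mul_le_mul_of_nonneg_left (Real.exp_le_exp.2 (by linarith)) (by positivity)
  have himage : (fun w => B / A * Real.exp w) '' univ = Ioi 0 := by
    ext u
    simp only [image_univ, mem_range, mem_Ioi]
    constructor
    · rintro ⟨w, rfl⟩
      positivity
    · intro hu
      refine ⟨Real.log (u / (B / A)), ?_⟩
      rw [Real.exp_log (by positivity)]
      field_simp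
  have hder : ∀ w ∈ (univ : Set ℝ), HasDerivWithinAt (fun w => B / A * Real.exp w)
      (B / A * Real.exp w) univ w :=
    fun w _ => ((Real.hasDerivAt_exp w).const_mul _).hasDerivWithinAt
  have hinj : InjOn (fun w => B / A * Real.exp w) univ := fun x _ y _ hxy =>
    Real.exp_injective (mul_left_cancel₀ hBA.ne' hxy)
  have hcomp : ∀ w : ℝ, |B / A * Real.exp w| • g (B / A * Real.exp w) =
      (B / A) ^ ν * (Real.exp (ν * w) * Real.exp (-(2 * A * B) * Real.cosh w)) := by
    intro w
    have hpos : 0 < B / A * Real.exp w := by positivity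
    have h1 : (B / A * Real.exp w) * (B / A * Real.exp w) ^ (ν - 1) =
        (B / A) ^ ν * Real.exp (ν * w) := by
      rw [mul_comm, ← Real.rpow_add_one hpos.ne', sub_add_cancel,
        Real.mul_rpow hBA.le (Real.exp_pos w).le, ← Real.exp_mul, mul_comm w]
    have h2 : A ^ 2 * (B / A * Real.exp w) + B ^ 2 / (B / A * Real.exp w) =
        2 * A * B * Real.cosh w := by
      rw [Real.cosh_eq, Real.exp_neg]
      field_simp
    rw [abs_of_pos hpos, smul_eq_mul, hg]
    simp only
    rw [← mul_assoc, h1, h2, mul_assoc, neg_mul]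
  have hint := (integrableOn_image_iff_integrableOn_abs_deriv_smul MeasurableSet.univ
    hder hinj g).1 (himage ▸ hgint)
  have heq := integral_image_eq_integral_abs_deriv_smul MeasurableSet.univ hder hinj g
  rw [himage] at heq
  simp only [hcomp, Measure.restrict_univ, IntegrableOn] at hint heq
  rw [heq, integral_const_mul, mul_comm 2 ((B / A) ^ ν), mul_assoc ((B / A) ^ ν),
    integral_eq_integral_Ioi_add_comp_neg
      ((integrable_const_mul_iff (Real.rpow_pos_of_pos hBA ν).ne'.isUnit _).1 hint),
    besselK, ← integral_const_mul (2 : ℝ)]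
  refine congrArg ((B / A) ^ ν * ·) (integral_congr_ae (ae_of_all _ fun w => ?_))
  simp only [Real.cosh_neg, Real.cosh_eq (ν * w), mul_neg]
  ring

theorem integral_rpow_mul_exp_neg_sq_add_sq {d : ℕ} (hd : 0 < d) {c : ℝ} (hc : 0 < c) (t : ℝ) :
    ∫ u in Ioi (0 : ℝ), u ^ ((d : ℝ) / 2 - 1) * Real.exp (-((c ^ 2 + t ^ 2) * u)) =
      Real.Gamma (d / 2) * (c ^ 2 + t ^ 2) ^ (-((d : ℝ) / 2)) := by
  rw [Real.integral_rpow_mul_exp_neg_mul_Ioi (by positivity) (by positivity), one_div,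
    Real.inv_rpow (by positivity), ← Real.rpow_neg (by positivity), mul_comm]

/-- The phase has modulus one, so integrating the norm over `u` gives a multiple of `f(t)`, which is
integrable. -/
theorem integrable_prod_fourier_kernel {d : ℕ} (hd : 2 ≤ d) {c : ℝ} (hc : 0 < c) (r : ℝ) :
    Integrable (Function.uncurry fun t u : ℝ =>
      Complex.exp (↑(-2 * Real.pi * t * r) * Complex.I) *
        ((u ^ ((d : ℝ) / 2 - 1) * Real.exp (-((c ^ 2 + t ^ 2) * u)) : ℝ) : ℂ))
      (volume.prod (volume.restrict (Ioi 0))) := by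
  have hd0 : 0 < d := by omega
  have hnorm : ∀ t : ℝ, ∀ u ∈ Ioi (0 : ℝ),
      ‖Complex.exp (↑(-2 * Real.pi * t * r) * Complex.I) *
        ((u ^ ((d : ℝ) / 2 - 1) * Real.exp (-((c ^ 2 + t ^ 2) * u)) : ℝ) : ℂ)‖ =
      u ^ ((d : ℝ) / 2 - 1) * Real.exp (-((c ^ 2 + t ^ 2) * u)) := by
    intro t u (hu : 0 < u)
    rw [norm_mul, Complex.norm_exp_ofReal_mul_I, one_mul, Complex.norm_real,
      Real.norm_of_nonneg (by positivity)]
  rw [integrable_prod_iff (by unfold Function.uncurry; fun_prop)]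
  refine ⟨ae_of_all _ fun t => ?_, ?_⟩
  · have h : Integrable (fun u : ℝ => u ^ ((d : ℝ) / 2 - 1) * Real.exp (-((c ^ 2 + t ^ 2) * u)))
        (volume.restrict (Ioi 0)) :=
      integrableOn_rpow_mul_exp_neg_mul_Ioi (by positivity) (by positivity)
    exact (h.ofReal (𝕜 := ℂ)).const_mul (Complex.exp (↑(-2 * Real.pi * t * r) * Complex.I))
  · refine ((integrable_imqSlice hd hc).const_mul
      (Real.Gamma (d / 2) * (c ^ ((d : ℝ) - 1))⁻¹)).congr (ae_of_all _ fun t => ?_)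
    simp only [Function.uncurry]
    rw [setIntegral_congr_fun measurableSet_Ioi (hnorm t),
      integral_rpow_mul_exp_neg_sq_add_sq hd0 hc, imqSlice]
    have := Real.rpow_pos_of_pos hc ((d : ℝ) - 1)
    field_simp

theorem integral_cexp_mul_gaussian {u : ℝ} (hu : 0 < u) (r : ℝ) :
    ∫ t : ℝ, Complex.exp (↑(-2 * Real.pi * t * r) * Complex.I) *
        (Real.exp (-(u * t ^ 2)) : ℝ) =
      ((√Real.pi * u ^ (-(1 / 2) : ℝ) * Real.exp (-((Real.pi * |r|) ^ 2 / u)) : ℝ) : ℂ) := by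
  have h := fourierIntegral_gaussian (b := u) (by simpa using hu) ((-2 * Real.pi * r : ℝ) : ℂ)
  have h1 : ((Real.pi : ℂ) / u) ^ (1 / 2 : ℂ) = ((√Real.pi * u ^ (-(1 / 2) : ℝ) : ℝ) : ℂ) := by
    rw [Real.sqrt_eq_rpow, Real.rpow_neg hu.le, ← div_eq_mul_inv,
      ← Real.div_rpow Real.pi_pos.le hu.le, Complex.ofReal_cpow (by positivity)]
    push_cast
    rfl
  rw [h1] at h
  rw [Complex.ofReal_mul, Complex.ofReal_exp]
  convert! h using 2
  · ext t
    rw [Complex.ofReal_exp]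
    push_cast
    congr 2 <;> ring
  · congr 1
    rw [mul_pow, sq_abs]
    have : (u : ℂ) ≠ 0 := by exact_mod_cast hu.ne'
    push_cast
    field_simp
    ring

theorem fourier_imqSlice {d : ℕ} (hd : 2 ≤ d) {c : ℝ} (hc : 0 < c) {r : ℝ} (hr : r ≠ 0) :
    𝓕 (fun t : ℝ => (imqSlice d c t : ℂ)) r = (imqSliceFourier d c r : ℂ) := by
  have hd' : (2 : ℝ) ≤ d := by exact_mod_cast hd
  have hd0 : 0 < d := by omega
  have hr' : 0 < |r| := abs_pos.2 hr
  have hΓ : 0 < Real.Gamma ((d : ℝ) / 2) := Real.Gamma_pos_of_pos (by positivity)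
  have houter : ∀ t : ℝ, Complex.exp (↑(-2 * Real.pi * t * r) * Complex.I) • (imqSlice d c t : ℂ) =
      ((c ^ ((d : ℝ) - 1) / Real.Gamma (d / 2) : ℝ) : ℂ) * ∫ u in Ioi (0 : ℝ),
        Complex.exp (↑(-2 * Real.pi * t * r) * Complex.I) *
        ((u ^ ((d : ℝ) / 2 - 1) * Real.exp (-((c ^ 2 + t ^ 2) * u)) : ℝ) : ℂ) := by
    intro t
    rw [integral_const_mul, integral_complex_ofReal, integral_rpow_mul_exp_neg_sq_add_sq hd0 hc,
      mul_left_comm, ← Complex.ofReal_mul, smul_eq_mul, imqSlice]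
    congr 2
    field_simp
  -- The Gaussian transform contributes `u^(-1/2)`, lowering the order from `d/2` to `(d-1)/2`.
  have hinner : ∀ u ∈ Ioi (0 : ℝ), (∫ t : ℝ,
      Complex.exp (↑(-2 * Real.pi * t * r) * Complex.I) *
        ((u ^ ((d : ℝ) / 2 - 1) * Real.exp (-((c ^ 2 + t ^ 2) * u)) : ℝ) : ℂ)) =
      ((√Real.pi * (u ^ (((d : ℝ) - 1) / 2 - 1) *
        Real.exp (-(c ^ 2 * u + (Real.pi * |r|) ^ 2 / u))) : ℝ) : ℂ) := by
    intro u (hu : 0 < u)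
    have h1 : ∀ t : ℝ, Complex.exp (↑(-2 * Real.pi * t * r) * Complex.I) *
        ((u ^ ((d : ℝ) / 2 - 1) * Real.exp (-((c ^ 2 + t ^ 2) * u)) : ℝ) : ℂ) =
        ((u ^ ((d : ℝ) / 2 - 1) * Real.exp (-(c ^ 2 * u)) : ℝ) : ℂ) *
          (Complex.exp (↑(-2 * Real.pi * t * r) * Complex.I) *
            (Real.exp (-(u * t ^ 2)) : ℝ)) := by
      intro t
      rw [show -((c ^ 2 + t ^ 2) * u) = -(c ^ 2 * u) + -(u * t ^ 2) by ring, Real.exp_add]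
      push_cast
      ring
    simp_rw [h1]
    rw [integral_const_mul, integral_cexp_mul_gaussian hu, ← Complex.ofReal_mul, neg_add,
      Real.exp_add, show ((d : ℝ) - 1) / 2 - 1 = (d / 2 - 1) + -(1 / 2) by ring,
      Real.rpow_add hu]
    congr 1
    ring
  rw [Real.fourier_real_eq_integral_exp_smul]
  simp_rw [houter]
  rw [integral_const_mul, integral_integral_swap (integrable_prod_fourier_kernel hd hc r),
    setIntegral_congr_fun measurableSet_Ioi hinner, integral_complex_ofReal, integral_const_mul,
    integral_rpow_mul_exp_neg_add_inv (by linarith) hc (by positivity), ← Complex.ofReal_mul,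
    imqSliceFourier, sphereArea]
  congr 1
  -- One half of the power cancels the denominator of `(π|r|/c)^((d-1)/2)`; the other joins `|r|` to
  -- form `(c|r|)^((d-1)/2)`.
  have h1 : c ^ ((d : ℝ) - 1) = c ^ (((d : ℝ) - 1) / 2) * c ^ (((d : ℝ) - 1) / 2) := by
    rw [← Real.rpow_add hc]
    ring_nf
  have h2 : Real.pi ^ ((d : ℝ) / 2) = √Real.pi * Real.pi ^ (((d : ℝ) - 1) / 2) := by
    rw [Real.sqrt_eq_rpow, ← Real.rpow_add Real.pi_pos]
    ring_nf
  have hcν := Real.rpow_pos_of_pos hc (((d : ℝ) - 1) / 2)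
  rw [h1, h2, Real.div_rpow (by positivity) hc.le, Real.mul_rpow Real.pi_pos.le hr'.le,
    Real.mul_rpow hc.le hr'.le,
    show 2 * c * (Real.pi * |r|) = 2 * Real.pi * c * |r| by ring]
  field_simp

theorem continuous_fourier {f : ℝ → ℂ} (hf : Integrable f) : Continuous (𝓕 f) :=
  VectorFourier.fourierIntegral_continuous Real.continuous_fourierChar
    (by fun_prop) hf

theorem proposition3p1 (d : ℕ) (hd : 3 ≤ d) (c : ℝ) (hc : 0 < c) :
    (∀ s : ℝ, 0 ≤ s →
      IntervalIntegrable (fun t : ℝ => imqSlice d c (t * s) * slicingDensity d t) volume 0 1 ∧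
      imqBasis c s = slicing d (imqSlice d c) s) ∧
    Integrable (imqSlice d c) ∧
    (∀ r : ℝ, r ≠ 0 →
      𝓕 (fun t : ℝ => (imqSlice d c t : ℂ)) r = (imqSliceFourier d c r : ℂ)) ∧
    Tendsto (fun r : ℝ => (imqSliceFourier d c r : ℂ)) (𝓝[≠] 0)
      (𝓝 (𝓕 (fun t : ℝ => (imqSlice d c t : ℂ)) 0)) := by
  have hd2 : 2 ≤ d := by omega
  have hint := integrable_imqSlice hd2 hc
  have hF : ∀ r : ℝ, r ≠ 0 →
      𝓕 (fun t : ℝ => (imqSlice d c t : ℂ)) r = (imqSliceFourier d c r : ℂ) :=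
    fun r hr => fourier_imqSlice hd2 hc hr
  refine ⟨fun s _ => ⟨Continuous.intervalIntegrable ?_ 0 1, (slicing_imqSlice hd hc s).symm⟩,
    hint, hF, ?_⟩
  -- As `d ≥ 3`, the exponent `(d-3)/2` is nonnegative, so there is no singularity at `t = 1`.
  · exact ((continuous_imqSlice d hc).comp (continuous_id.mul continuous_const)).mul
      (continuous_slicingDensity hd)
  · refine Tendsto.congr' ?_
      (((continuous_fourier hint.ofReal).tendsto 0).mono_left nhdsWithin_le_nhds)
    filter_upwards [self_mem_nhdsWithin] with r hr using hF r hr
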